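/- Let $m,k\ge 1$, $n=m+k$, and let $$A=\begin{bmatrix}A_{11}&A_{12}\\0&A_{22}\end{bmatrix},\qquad E=\begin{bmatrix}E_{11}&E_{12}\\E_{21}&E_{22}\end{bmatrix}$$ be complex $n\times n$ matrices, where $A_{11},E_{11}$ are $m\times m$. Write $\|\cdot\|_2$ for the spectral norm and $\mathrm{span}(X)$ for the column space of a matrix $X$. A pair $(X,M)$ is a right invariant pair of an $n\times n$ matrix $B$ if $X\in\mathbb C^{n\times p}$ has rank $p$ and $BX=XM$; a pair $(Y,L)$ is a left invariant pair of $B$ if $Y\in\mathbb C^{n\times p}$ has rank $p$ and $Y^*B=LY^*$. The largest canonical angle $\theta_{\max}(\mathcal X,\mathcal Y)\in[0,\pi/2]$ between two subspaces of the same dimension is defined by $\cos\theta_{\max}(\mathcal X,\mathcal Y)=\sigma_{\min}(V^*U)$ (the smallest singular value), where the columns of $U$ and $V$ are orthonormal bases of $\mathcal X$ and $\mathcal Y$. Suppose that $$s:=\mathrm{sep}(A_{22},A_{11}):=\min\{\|A_{22}Z-ZA_{11}\|_2 : Z\in\mathbb C^{k\times m},\ \|Z\|_2=1\}>0\quad\text{and}\quad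 4\|E\|_2(\|E\|_2+\|A_{12}\|_2)<s^2 .$$ For $X\in\mathbb C^{k\times m}$ put $M:=A_{11}+E_{11}+(A_{12}+E_{12})X$ and $N:=A_{22}+E_{22}-X(A_{12}+E_{12})$. Then there is a matrix $X\in\mathbb C^{k\times m}$ with the following properties. (a) $\left(\begin{bmatrix}I_m\\X\end{bmatrix},M\right)$ is a right invariant pair of $A+E$, $\left(\begin{bmatrix}-X^*\\I_k\end{bmatrix},N\right)$ is a left invariant pair of $A+E$, and $$\|X\|_2\le\frac{2\|E\|_2}{s+\sqrt{s^2-4(\|A_{12}\|_2+\|E\|_2)\|E\|_2}}\le\frac{2\|E\|_2}{s}.$$ Moreover, $X$ is the only matrix with $\|X\|_2\le 2\|E\|_2/s$ for which these two pairs are right and left invariant pairs of $A+E$. (b) Let $\mathcal X:=\mathrm{span}\begin{bmatrix}I_m\\0\end{bmatrix}$ and $\mathcal X_E:=\mathrm{span}\begin{bmatrix}I_m\\X\end{bmatrix}$. Then $A\mathcal X\subset\mathcal X$, $(A+E)\mathcal X_E\subset\mathcal X_E$, $\theta_{\max}(\mathcal X,\mathcal X_E)<\pi/2$ and $\tan\theta_{\max}(\mathcal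 X,\mathcal X_E)=\|X\|_2$. (c) Let $\mathcal Y:=\mathrm{span}\begin{bmatrix}0\\I_k\end{bmatrix}$ and $\mathcal Y_E:=\mathrm{span}\begin{bmatrix}-X^*\\I_k\end{bmatrix}$. Then $A^*\mathcal Y\subset\mathcal Y$, $(A+E)^*\mathcal Y_E\subset\mathcal Y_E$, $\theta_{\max}(\mathcal Y,\mathcal Y_E)<\pi/2$ and $\tan\theta_{\max}(\mathcal Y,\mathcal Y_E)=\|X\|_2$. -/

import Mathlib

open scoped Matrix Matrix.Norms.L2Operator

/-! Throughout, `‖A‖` of a matrix is its spectral norm (`Matrix.Norms.L2Operator`). -/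

namespace InvPert

/-- The separation `sep(A, B)`: the minimum of `‖A X - X B‖₂` over all `X` with `‖X‖₂ = 1`. -/
noncomputable def sep {m n : Type*} [Fintype m] [DecidableEq m] [Fintype n] [DecidableEq n]
    (A : Matrix m m ℂ) (B : Matrix n n ℂ) : ℝ :=
  sInf {r : ℝ | ∃ X : Matrix m n ℂ, ‖X‖ = 1 ∧ r = ‖A * X - X * B‖}

/-- The minimum in `sep` is attained as soon as there is a matrix of norm one. -/
theorem isLeast_sep {m n : Type*} [Fintype m] [DecidableEq m] [Fintype n] [DecidableEq n]
    [Nonempty m] [Nonempty n] (A : Matrix m m ℂ) (B : Matrix n n ℂ) :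
    IsLeast {r : ℝ | ∃ X : Matrix m n ℂ, ‖X‖ = 1 ∧ r = ‖A * X - X * B‖} (sep A B) := by
  have : ProperSpace (Matrix m n ℂ) := FiniteDimensional.proper ℂ _
  have hset : {r : ℝ | ∃ X : Matrix m n ℂ, ‖X‖ = 1 ∧ r = ‖A * X - X * B‖}
      = (fun X : Matrix m n ℂ => ‖A * X - X * B‖) '' Metric.sphere 0 1 := by
    ext r
    simp [eq_comm]
  have hcont : Continuous fun X : Matrix m n ℂ => ‖A * X - X * B‖ := by
    have h1 : Continuous fun X : Matrix m n ℂ => A * X - X * B := by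
      let L : Matrix m n ℂ →ₗ[ℂ] Matrix m n ℂ :=
        { toFun := fun X => A * X - X * B
          map_add' := fun X Y => by rw [Matrix.mul_add, Matrix.add_mul]; abel
          map_smul' := fun c X => by simp [smul_sub] }
      exact L.continuous_of_finiteDimensional
    exact h1.norm
  unfold sep
  rw [hset]
  exact ((isCompact_sphere _ _).image hcont).isLeast_sInf
    ((NormedSpace.sphere_nonempty.2 zero_le_one).image _)

/-- The column space of a matrix, as a subspace of `ℂⁿ` with the Euclidean norm. -/
noncomputable def colSpan {n p : Type*} [Fintype n] [Fintype p] [DecidableEq p]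
    (X : Matrix n p ℂ) : Submodule ℂ (EuclideanSpace ℂ n) :=
  LinearMap.range (Matrix.toEuclideanLin X)

/-- `A 𝒳 ⊆ 𝒳`. -/
def IsInvariantSubspace {n : Type*} [Fintype n] [DecidableEq n]
    (A : Matrix n n ℂ) (S : Submodule ℂ (EuclideanSpace ℂ n)) : Prop :=
  ∀ x ∈ S, Matrix.toEuclideanLin A x ∈ S

/-- The block matrix `[I; X]`. -/
def rightBasis {m k : ℕ} (X : Matrix (Fin k) (Fin m) ℂ) : Matrix (Fin m ⊕ Fin k) (Fin m) ℂ :=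
  Matrix.fromRows 1 X

/-- The block matrix `[Z; I]`. -/
def leftBasis {m k : ℕ} (Z : Matrix (Fin m) (Fin k) ℂ) : Matrix (Fin m ⊕ Fin k) (Fin k) ℂ :=
  Matrix.fromRows Z 1

/-- `(X, M)` is a right invariant pair of `A`: `X` has full column rank and `A X = X M`. -/
def IsRightInvariantPair {n p : Type*} [Fintype n] [Fintype p]
    (A : Matrix n n ℂ) (X : Matrix n p ℂ) (M : Matrix p p ℂ) : Prop :=
  X.rank = Fintype.card p ∧ A * X = X * M

/-- `(Y, L)` is a left invariant pair of `A`: `Y` has full column rank and `Y* A = L Y*`. -/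
def IsLeftInvariantPair {n p : Type*} [Fintype n] [Fintype p]
    (A : Matrix n n ℂ) (Y : Matrix n p ℂ) (L : Matrix p p ℂ) : Prop :=
  Y.rank = Fintype.card p ∧ Yᴴ * A = L * Yᴴ

/-- The smallest singular value of a matrix with `p` columns, that is, the `p`-th one in
decreasing order (Mathlib numbers singular values from `0`). -/
noncomputable def sigmaMin {q p : Type*} [Fintype q] [Fintype p] [DecidableEq p]
    (M : Matrix q p ℂ) : ℝ :=
  (Matrix.toEuclideanLin M).singularValues (Fintype.card p - 1)

/-- A matrix whose columns form an orthonormal basis of the subspace `S`. -/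
noncomputable def isometryOf {n : Type*} [Fintype n] (S : Submodule ℂ (EuclideanSpace ℂ n)) :
    Matrix n (Fin (Module.finrank ℂ S)) ℂ :=
  Matrix.of fun i j => (stdOrthonormalBasis ℂ S j : EuclideanSpace ℂ n) i

/-- The largest canonical angle in `[0, π/2]` between two subspaces of the same dimension:
`cos θ_max(𝒳, 𝒴) = σ_min(Y* X)`, where `X`, `Y` are isometries with column spaces `𝒳`, `𝒴`.
By `thetaMax_eq` below, the choice of `X` and `Y` does not matter. -/
noncomputable def thetaMax {n : Type*} [Fintype n] (S T : Submodule ℂ (EuclideanSpace ℂ n)) : ℝ :=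
  Real.arccos (sigmaMin ((isometryOf T)ᴴ * isometryOf S))

theorem norm_toEuclideanLin_of_isometry {n p : Type*} [Fintype n] [Fintype p]
    [DecidableEq p] {X : Matrix n p ℂ} (hX : Xᴴ * X = 1) (v : EuclideanSpace ℂ p) :
    ‖Matrix.toEuclideanLin X v‖ = ‖v‖ := by
  classical
  have h : inner ℂ (Matrix.toEuclideanLin X v) (Matrix.toEuclideanLin X v) = inner ℂ v v := by
    rw [← LinearMap.adjoint_inner_right, ← Matrix.toEuclideanLin_conjTranspose_eq_adjoint]
    congr 1
    ext i
    simp [Matrix.toLpLin_apply, Matrix.mulVec_mulVec, hX]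
  rw [inner_self_eq_norm_sq_to_K, inner_self_eq_norm_sq_to_K] at h
  have h2 : ‖Matrix.toEuclideanLin X v‖ ^ 2 = ‖v‖ ^ 2 := by exact_mod_cast h
  exact (sq_eq_sq₀ (norm_nonneg _) (norm_nonneg _)).1 h2

theorem isometryOf_isometry {n : Type*} [Fintype n] (S : Submodule ℂ (EuclideanSpace ℂ n)) :
    (isometryOf S)ᴴ * isometryOf S = 1 := by
  ext i j
  have h := orthonormal_iff_ite.1 (stdOrthonormalBasis ℂ S).orthonormal i j
  rw [Submodule.coe_inner, PiLp.inner_apply] at h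
  simpa [Matrix.mul_apply, isometryOf, Matrix.one_apply, mul_comm] using h

theorem colSpan_isometryOf {n : Type*} [Fintype n] (S : Submodule ℂ (EuclideanSpace ℂ n)) :
    colSpan (isometryOf S) = S := by
  have key : ∀ v : EuclideanSpace ℂ (Fin (Module.finrank ℂ S)),
      Matrix.toEuclideanLin (isometryOf S) v
        = ((∑ j, v j • stdOrthonormalBasis ℂ S j : S) : EuclideanSpace ℂ n) := by
    intro v
    ext i
    simp [Matrix.toLpLin_apply, Matrix.mulVec, dotProduct, isometryOf, mul_comm]
  apply le_antisymm
  · rintro _ ⟨v, rfl⟩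
    rw [key]
    exact Submodule.coe_mem _
  · intro x hx
    refine ⟨(stdOrthonormalBasis ℂ S).repr ⟨x, hx⟩, ?_⟩
    rw [key, (stdOrthonormalBasis ℂ S).sum_repr]

/-- The smallest singular value of `M` is the minimum of `‖M v‖` over unit vectors `v`. -/
theorem isLeast_sigmaMin {q p : Type*} [Fintype q] [Fintype p] [DecidableEq p] [Nonempty p]
    (M : Matrix q p ℂ) :
    IsLeast {r : ℝ | ∃ v : EuclideanSpace ℂ p, ‖v‖ = 1 ∧ r = ‖Matrix.toEuclideanLin M v‖}
      (sigmaMin M) := by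
  set T := Matrix.toEuclideanLin M with hT
  obtain ⟨N, hN⟩ : ∃ N, Fintype.card p = N + 1 :=
    ⟨Fintype.card p - 1, by have := Fintype.card_pos (α := p); omega⟩
  have hn : Module.finrank ℂ (EuclideanSpace ℂ p) = N + 1 := by simp [hN]
  have hs := T.isSymmetric_adjoint_comp_self
  set b := hs.eigenvectorBasis hn with hb
  have hσ : sigmaMin M = T.singularValues (Fin.last N : Fin (N + 1)) := by
    simp [sigmaMin, hN, hT]
  have hnorm : ∀ v, ‖T v‖ ^ 2 = ∑ i, hs.eigenvalues hn i * ‖b.repr v i‖ ^ 2 := by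
    intro v
    have h1 : inner ℂ (T v) (T v) = inner ℂ v ((LinearMap.adjoint T ∘ₗ T) v) := by
      rw [LinearMap.comp_apply, LinearMap.adjoint_inner_right]
    rw [inner_self_eq_norm_sq_to_K, ← b.repr.inner_map_map, PiLp.inner_apply] at h1
    have h2 : ((‖T v‖ ^ 2 : ℝ) : ℂ)
        = ((∑ i, hs.eigenvalues hn i * ‖b.repr v i‖ ^ 2 : ℝ) : ℂ) := by
      push_cast
      refine Eq.trans (by simp) (h1.trans (Finset.sum_congr rfl fun i _ => ?_))
      rw [hb, hs.eigenvectorBasis_apply_self_apply hn v i, ← hb]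
      have h3 := RCLike.mul_conj (b.repr v i)
      simp only [RCLike.inner_apply, mul_assoc, h3]
      simp
    exact_mod_cast h2
  rw [hσ]
  have hsq := T.sq_singularValues_fin hn (Fin.last N)
  constructor
  · refine ⟨b (Fin.last N), b.orthonormal.1 _, ?_⟩
    have h := hnorm (b (Fin.last N))
    rw [b.repr_self] at h
    have h2 : ‖T (b (Fin.last N))‖ ^ 2 = hs.eigenvalues hn (Fin.last N) := by
      rw [h, Finset.sum_eq_single (Fin.last N)]
      · simp
      · intro i _ hi
        simp [hi]
      · simp
    rw [← hsq] at h2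
    exact ((sq_eq_sq₀ (norm_nonneg _) (T.singularValues_nonneg _)).1 h2).symm
  · rintro r ⟨v, hv, rfl⟩
    refine le_of_sq_le_sq ?_ (norm_nonneg _)
    rw [hsq, hnorm]
    have h1 : ∑ i, ‖b.repr v i‖ ^ 2 = 1 := by
      rw [← EuclideanSpace.norm_sq_eq, b.repr.norm_map, hv, one_pow]
    calc hs.eigenvalues hn (Fin.last N)
        = ∑ i, hs.eigenvalues hn (Fin.last N) * ‖b.repr v i‖ ^ 2 := by
          rw [← Finset.mul_sum, h1, mul_one]
      _ ≤ _ := Finset.sum_le_sum fun i _ =>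
          mul_le_mul_of_nonneg_right (hs.eigenvalues_antitone hn (Fin.le_last i)) (by positivity)

/-- For isometries `X`, `Y`, the number `σ_min(Y* X)` is the minimum of the norm of the
orthogonal projection on `span Y` of a unit vector in `span X`. -/
theorem isLeast_sigmaMin_isometry {n p q : Type*} [Fintype n] [Fintype p]
    [DecidableEq p] [Nonempty p] [Fintype q] [DecidableEq q]
    {X : Matrix n p ℂ} {Y : Matrix n q ℂ} (hX : Xᴴ * X = 1) (hY : Yᴴ * Y = 1) :
    IsLeast {r : ℝ | ∃ u ∈ colSpan X, ‖u‖ = 1 ∧ r = ‖(colSpan Y).starProjection u‖}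
      (sigmaMin (Yᴴ * X)) := by
  classical
  have hproj : ∀ u : EuclideanSpace ℂ n, (colSpan Y).starProjection u
      = Matrix.toEuclideanLin Y (Matrix.toEuclideanLin Yᴴ u) := by
    intro u
    refine Submodule.eq_starProjection_of_mem_of_inner_eq_zero (K := colSpan Y)
      (LinearMap.mem_range_self (Matrix.toEuclideanLin Y) _) ?_
    rintro _ ⟨w, rfl⟩
    rw [← LinearMap.adjoint_inner_left, ← Matrix.toEuclideanLin_conjTranspose_eq_adjoint,
      map_sub]
    have : Matrix.toEuclideanLin Yᴴ (Matrix.toEuclideanLin Y (Matrix.toEuclideanLin Yᴴ u))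
        = Matrix.toEuclideanLin Yᴴ u := by
      ext i
      simp [Matrix.toLpLin_apply, Matrix.mulVec_mulVec, ← Matrix.mul_assoc, hY]
    rw [this, sub_self, inner_zero_left]
  have hset : {r : ℝ | ∃ u ∈ colSpan X, ‖u‖ = 1 ∧ r = ‖(colSpan Y).starProjection u‖}
      = {r : ℝ | ∃ v : EuclideanSpace ℂ p, ‖v‖ = 1 ∧
          r = ‖Matrix.toEuclideanLin (Yᴴ * X) v‖} := by
    have hcomp : ∀ v : EuclideanSpace ℂ p, ‖Matrix.toEuclideanLin (Yᴴ * X) v‖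
        = ‖(colSpan Y).starProjection (Matrix.toEuclideanLin X v)‖ := by
      intro v
      rw [hproj, norm_toEuclideanLin_of_isometry hY]
      congr 1
      ext i
      simp [Matrix.toLpLin_apply, Matrix.mulVec_mulVec]
    ext r
    constructor
    · rintro ⟨_, ⟨v, rfl⟩, hu, rfl⟩
      exact ⟨v, by rwa [norm_toEuclideanLin_of_isometry hX] at hu, (hcomp v).symm⟩
    · rintro ⟨v, hv, rfl⟩
      exact ⟨_, ⟨v, rfl⟩, by rwa [norm_toEuclideanLin_of_isometry hX], hcomp v⟩
  rw [hset]
  exact isLeast_sigmaMin _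

/-- The largest canonical angle may be computed from any isometries spanning the subspaces. -/
theorem thetaMax_eq {n p q : Type*} [Fintype n] [Fintype p]
    [DecidableEq p] [Nonempty p] [Fintype q] [DecidableEq q]
    {X : Matrix n p ℂ} {Y : Matrix n q ℂ} (hX : Xᴴ * X = 1) (hY : Yᴴ * Y = 1) :
    thetaMax (colSpan X) (colSpan Y) = Real.arccos (sigmaMin (Yᴴ * X)) := by
  have hpos : 0 < Module.finrank ℂ (colSpan X) := by
    obtain ⟨i⟩ := ‹Nonempty p›
    let e : EuclideanSpace ℂ p := EuclideanSpace.single i 1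
    have hne : (⟨Matrix.toEuclideanLin X e, ⟨e, rfl⟩⟩ : colSpan X) ≠ 0 := by
      intro h
      have h1 := norm_toEuclideanLin_of_isometry hX e
      rw [Subtype.ext_iff] at h
      simp only [Submodule.coe_zero] at h
      rw [h] at h1
      simp [e] at h1
    exact Module.finrank_pos_iff_exists_ne_zero.2 ⟨_, hne⟩
  have : Nonempty (Fin (Module.finrank ℂ (colSpan X))) := ⟨⟨0, hpos⟩⟩
  have h1 := isLeast_sigmaMin_isometry hX hY
  have h2 := isLeast_sigmaMin_isometry (isometryOf_isometry (colSpan X))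
    (isometryOf_isometry (colSpan Y))
  rw [colSpan_isometryOf, colSpan_isometryOf] at h2
  rw [thetaMax, h2.unique h1]

end InvPert

open InvPert

/-! Both invariant-pair equations reduce to one Riccati equation, `T X = X (A₁₂ + E₁₂) X - E₂₁ -
(E₂₂ X - X E₁₁)` with `T X = A₂₂ X - X A₁₁`. Since `s ‖X‖ ≤ ‖T X‖`, `T` is invertible and solutions
are fixed points of `φ = T⁻¹ ∘ (right-hand side)`.

Put `ε = ‖E‖`, `γ = ‖A₁₂‖ + ‖E‖`. The terms from `E` form `-[-X, I] E [I; X]`, so the right-hand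
side is at most `ε + γ ‖X‖²`, with no linear term (`norm_fromBlocks_riccati_le`). The hypothesis
`4εγ < s²` then yields a ball that `φ` maps strictly inside itself (`exists_radius`). Termwise
Lipschitz bounds need not make `φ` a contraction, but `φ` is holomorphic, so an Earle–Hamilton
argument gives exactly one fixed point (`existsUnique_fixedPoint_of_mapsTo_closedBall`). The
quadratic inequality for `‖X‖` gives the sharp bound (`le_smaller_root`).

The angles come from `thetaMax_colSpan_add_mul`: a graph of `Z` over a subspace makes largest angle
`arctan ‖Z‖` with it. -/

/-! ### Fixed points of holomorphic self-maps of a ball -/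

open Metric in
/-- A quantitative form of the Earle–Hamilton theorem on a ball. -/
theorem dist_iterate_le_of_mapsTo_closedBall {V : Type*} [NormedAddCommGroup V] [NormedSpace ℂ V]
    {φ : V → V} {K ρ η : ℝ} (hφ : Differentiable ℂ φ) (hη : 0 < η) (hηρ : η < ρ) (hK : 0 ≤ K)
    (hmaps : ∀ x, ‖x‖ ≤ ρ → ‖φ x‖ ≤ η)
    (hlip : ∀ x y, ‖x‖ ≤ ρ → ‖y‖ ≤ ρ → ‖φ x - φ y‖ ≤ K * ‖x - y‖)
    {x y : V} (hx : ‖x‖ ≤ ρ) (hy : ‖y‖ ≤ ρ) (n : ℕ) :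
    ‖φ^[n + 1] x - φ^[n + 1] y‖ ≤ 2 * ρ * (η / ρ) ^ (n + 1) := by
  have hρ : 0 < ρ := hη.trans hηρ
  -- A complex parameter is inserted: iterate `t • φ`. This still preserves the ball for `‖t‖ ≤ ρ /
  -- η`, a disc with `1` in its interior, and `t = 1` recovers `φ`.
  let h : ℕ → V → ℂ → V := fun n v t => (fun w => t • φ w)^[n] v
  have hsucc : ∀ n v t, h (n + 1) v t = t • φ (h n v t) := fun n v t =>
    Function.iterate_succ_apply' _ _ _
  have hdiff : ∀ n v, Differentiable ℂ (h n v) := by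
    intro n v
    induction n with
    | zero => exact differentiable_const v
    | succ n ih =>
      have : h (n + 1) v = fun t => t • φ (h n v t) := funext fun t => hsucc n v t
      rw [this]
      exact differentiable_id.smul (hφ.comp ih)
  have hball : ∀ n v (t : ℂ), ‖v‖ ≤ ρ → ‖t‖ ≤ ρ / η → ‖h n v t‖ ≤ ρ := by
    intro n v t hv ht
    induction n with
    | zero => exact hv
    | succ n ih =>
      rw [hsucc, norm_smul]
      calc ‖t‖ * ‖φ (h n v t)‖ ≤ ρ / η * η :=
            mul_le_mul ht (hmaps _ ih) (norm_nonneg _) (by positivity)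
        _ = ρ := by field_simp
  -- Each iteration contributes a factor `t`, so the difference of two orbits vanishes to order `n`
  -- at `t = 0`. The size of `K` does not enter the final estimate.
  have hsmall : ∀ n (t : ℂ), ‖t‖ ≤ ρ / η → ‖h n x t - h n y t‖ ≤ (K * ‖t‖) ^ n * ‖x - y‖ := by
    intro n t ht
    induction n with
    | zero => simp [h]
    | succ n ih =>
      rw [hsucc, hsucc, ← smul_sub, norm_smul]
      calc ‖t‖ * ‖φ (h n x t) - φ (h n y t)‖
          ≤ ‖t‖ * (K * ((K * ‖t‖) ^ n * ‖x - y‖)) := by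
            gcongr
            exact (hlip _ _ (hball n x t hx ht) (hball n y t hy ht)).trans (by gcongr)
        _ = _ := by ring
  let f : ℂ → V := fun t => h (n + 1) x t - h (n + 1) y t
  have hf0 : f 0 = 0 := by simp [f, hsucc]
  have hR : (1 : ℝ) < ρ / η := (one_lt_div hη).2 hηρ
  have hO : f =O[nhds 0] fun t : ℂ => ‖t‖ ^ (n + 1) := by
    refine Asymptotics.IsBigO.of_bound (K ^ (n + 1) * ‖x - y‖) ?_
    filter_upwards [closedBall_mem_nhds (0 : ℂ) (zero_lt_one.trans hR)] with t ht
    refine (hsmall (n + 1) t (by simpa using ht)).trans_eq ?_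
    rw [Real.norm_of_nonneg (by positivity)]
    ring
  have hpow : (fun t : ℂ => ‖t‖ ^ (n + 1)) =o[nhds 0] fun t : ℂ => ‖t‖ ^ n :=
    (Asymptotics.isLittleO_pow_pow n.lt_succ_self).comp_tendsto
      (by simpa using (continuous_norm (E := ℂ)).tendsto 0)
  -- Higher-order Schwarz lemma at `t = 1`: a zero of order `n + 1` and the bound `2ρ` on the disc
  -- of radius `ρ / η`.
  have key := Complex.dist_le_mul_div_pow_of_mapsTo_ball_of_isLittleO (f := f) (c := 0) (z := 1)
    (R₁ := ρ / η) (R₂ := 2 * ρ) (n := n) ((hdiff _ _).sub (hdiff _ _)).differentiableOn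
    (fun t ht => by
      have ht' : ‖t‖ ≤ ρ / η := by simpa using (mem_ball.1 ht).le
      rw [hf0, mem_closedBall_zero_iff]
      exact (norm_sub_le _ _).trans
        (by linarith [hball (n + 1) x t hx ht', hball (n + 1) y t hy ht']))
    (by simpa [hf0] using hO.trans_isLittleO hpow) (by simpa using hR)
  have h1 : ∀ v, h (n + 1) v 1 = φ^[n + 1] v := fun v => by simp [h]
  simpa [hf0, f, h1] using key

open Filter Topology in
/-- A holomorphic map sending a closed ball strictly inside itself has a unique fixed point
there. -/
theorem existsUnique_fixedPoint_of_mapsTo_closedBall {V : Type*} [NormedAddCommGroup V]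
    [NormedSpace ℂ V] [FiniteDimensional ℂ V] {φ : V → V} {ρ η : ℝ} (hφ : ContDiff ℂ 1 φ)
    (hη : 0 < η) (hηρ : η < ρ) (hmaps : ∀ x, ‖x‖ ≤ ρ → ‖φ x‖ ≤ η) :
    ∃! x, ‖x‖ ≤ ρ ∧ φ x = x := by
  have hρ : 0 < ρ := hη.trans hηρ
  have : ProperSpace V := FiniteDimensional.proper ℂ V
  let _ : NormedSpace ℝ V := NormedSpace.restrictScalars ℝ ℂ V
  obtain ⟨K, hK⟩ := (hφ.restrict_scalars ℝ).contDiffOn.exists_lipschitzOnWith one_ne_zero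
    (convex_closedBall (0 : V) ρ) (isCompact_closedBall (0 : V) ρ)
  have hit := fun {x y : V} => dist_iterate_le_of_mapsTo_closedBall (x := x) (y := y)
    (hφ.differentiable one_ne_zero) hη hηρ K.2 hmaps
    (fun x y hx hy => by
      simpa [dist_eq_norm] using hK.dist_le_mul x (by simpa using hx) y (by simpa using hy))
  have hr0 : 0 ≤ η / ρ := by positivity
  have hr1 : η / ρ < 1 := (div_lt_one hρ).2 hηρ
  have hlim : Tendsto (fun n : ℕ => 2 * ρ * (η / ρ) ^ (n + 1)) atTop (𝓝 0) := by
    simpa using ((tendsto_pow_atTop_nhds_zero_of_lt_one hr0 hr1).comp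
      (tendsto_add_atTop_nat 1)).const_mul (2 * ρ)
  have h0 : ‖(0 : V)‖ ≤ ρ := by simpa using hρ.le
  have hb : ∀ n, ‖φ^[n] 0‖ ≤ ρ := by
    intro n
    induction n with
    | zero => exact h0
    | succ n ih =>
      rw [Function.iterate_succ_apply']
      exact (hmaps _ ih).trans hηρ.le
  -- Consecutive iterates are iterates of the two starting points `0` and `φ 0`, so the orbit
  -- estimate makes their distances geometric.
  have hc : CauchySeq fun n => φ^[n + 1] (0 : V) := by
    refine cauchySeq_of_le_geometric (η / ρ) (2 * ρ * (η / ρ)) hr1 fun n => ?_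
    rw [dist_eq_norm, Function.iterate_succ_apply φ (n + 1)]
    refine (hit h0 ((hmaps 0 h0).trans hηρ.le) n).trans_eq ?_
    ring
  obtain ⟨x, hx⟩ := cauchySeq_tendsto_of_complete hc
  refine ⟨x, ⟨le_of_tendsto hx.norm (.of_forall fun n => hb _), ?_⟩, ?_⟩
  · refine tendsto_nhds_unique ((hφ.continuous.tendsto x).comp hx) ?_
    refine (hx.comp (tendsto_add_atTop_nat 1)).congr fun n => ?_
    exact Function.iterate_succ_apply' φ (n + 1) 0
  · rintro y ⟨hy, hfy⟩
    have hn : Tendsto (fun n => φ^[n + 1] (0 : V) - y) atTop (𝓝 0) := by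
      refine squeeze_zero_norm (fun n => ?_) hlim
      have := hit h0 hy n
      rwa [Function.iterate_fixed hfy] at this
    exact (sub_eq_zero.1 (tendsto_nhds_unique (hx.sub_const y) hn)).symm

/-! ### Invariant pairs and the Riccati equation -/

theorem rank_eq_card_of_mul_eq_one {n p : Type*} [Fintype n] [Fintype p] [DecidableEq p]
    {Y : Matrix p n ℂ} {X : Matrix n p ℂ} (h : Y * X = 1) : X.rank = Fintype.card p := by
  refine le_antisymm (Matrix.rank_le_card_width X) ?_
  have := Matrix.rank_mul_le_right Y X
  rwa [h, Matrix.rank_one] at this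

theorem isInvariantSubspace_colSpan {n p : Type*} [Fintype n] [DecidableEq n] [Fintype p]
    [DecidableEq p] {B : Matrix n n ℂ} {X : Matrix n p ℂ} {M : Matrix p p ℂ}
    (h : B * X = X * M) : IsInvariantSubspace B (colSpan X) := by
  rintro _ ⟨v, rfl⟩
  refine ⟨Matrix.toEuclideanLin M v, ?_⟩
  ext i
  simp [Matrix.toLpLin_apply, Matrix.mulVec_mulVec, h]

section Riccati

variable {m k : ℕ} (B₁₁ : Matrix (Fin m) (Fin m) ℂ) (B₁₂ : Matrix (Fin m) (Fin k) ℂ)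
  (B₂₁ : Matrix (Fin k) (Fin m) ℂ) (B₂₂ : Matrix (Fin k) (Fin k) ℂ)
  (X : Matrix (Fin k) (Fin m) ℂ)

/-- The top block holds identically by the choice of `M`; only the bottom block is a condition on
`X`. -/
theorem fromBlocks_mul_rightBasis_iff :
    Matrix.fromBlocks B₁₁ B₁₂ B₂₁ B₂₂ * rightBasis X = rightBasis X * (B₁₁ + B₁₂ * X) ↔
      B₂₁ + B₂₂ * X = X * B₁₁ + X * B₁₂ * X := by
  rw [rightBasis, Matrix.fromBlocks_mul_fromRows, Matrix.fromRows_mul, Matrix.fromRows_inj.eq_iff]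
  simp [Matrix.mul_add, Matrix.mul_assoc]

theorem conjTranspose_leftBasis_neg :
    (leftBasis (-Xᴴ))ᴴ = Matrix.fromCols (-X) 1 := by
  simp [leftBasis, Matrix.conjTranspose_fromRows_eq_fromCols_conjTranspose]

/-- The second block column holds identically by the choice of `N`; the first is the same Riccati
equation as for the right pair, so one `X` serves both. -/
theorem leftBasis_mul_fromBlocks_iff :
    (leftBasis (-Xᴴ))ᴴ * Matrix.fromBlocks B₁₁ B₁₂ B₂₁ B₂₂
        = (B₂₂ - X * B₁₂) * (leftBasis (-Xᴴ))ᴴ ↔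
      B₂₁ + B₂₂ * X = X * B₁₁ + X * B₁₂ * X := by
  rw [conjTranspose_leftBasis_neg, Matrix.fromCols_mul_fromBlocks, Matrix.mul_fromCols,
    Matrix.fromCols_inj.eq_iff]
  simp only [Matrix.neg_mul, Matrix.one_mul, Matrix.mul_neg, Matrix.mul_one, Matrix.sub_mul]
  constructor
  · rintro ⟨h, -⟩
    rw [← sub_eq_zero] at h ⊢
    rw [← h]
    abel
  · intro h
    refine ⟨?_, by abel⟩
    rw [← sub_eq_zero] at h ⊢
    rw [← h]
    abel

theorem rank_rightBasis : (rightBasis X).rank = Fintype.card (Fin m) :=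
  rank_eq_card_of_mul_eq_one (Y := Matrix.fromCols 1 0) (by
    simp [rightBasis, Matrix.fromCols_mul_fromRows])

theorem rank_leftBasis (Z : Matrix (Fin m) (Fin k) ℂ) :
    (leftBasis Z).rank = Fintype.card (Fin k) :=
  rank_eq_card_of_mul_eq_one (Y := Matrix.fromCols 0 1) (by
    simp [leftBasis, Matrix.fromCols_mul_fromRows])

theorem norm_one_add_conjTranspose_mul_self_le {q p : Type*} [Fintype q] [DecidableEq q]
    [Fintype p] [DecidableEq p] (Y : Matrix q p ℂ) : ‖1 + Yᴴ * Y‖ ≤ 1 + ‖Y‖ ^ 2 := by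
  refine (norm_add_le _ _).trans (add_le_add ?_ ?_)
  · rw [← Matrix.diagonal_one, Matrix.l2_opNorm_diagonal]
    exact (pi_norm_le_iff_of_nonneg zero_le_one).2 fun _ => by simp
  · rw [Matrix.l2_opNorm_conjTranspose_mul_self, sq]

theorem norm_rightBasis_le : ‖rightBasis X‖ ≤ √(1 + ‖X‖ ^ 2) := by
  refine Real.le_sqrt_of_sq_le ?_
  rw [sq, ← Matrix.l2_opNorm_conjTranspose_mul_self, rightBasis,
    Matrix.conjTranspose_fromRows_eq_fromCols_conjTranspose, Matrix.fromCols_mul_fromRows]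
  simpa using norm_one_add_conjTranspose_mul_self_le X

theorem norm_leftBasis_le (Z : Matrix (Fin m) (Fin k) ℂ) :
    ‖leftBasis Z‖ ≤ √(1 + ‖Z‖ ^ 2) := by
  refine Real.le_sqrt_of_sq_le ?_
  rw [sq, ← Matrix.l2_opNorm_conjTranspose_mul_self, leftBasis,
    Matrix.conjTranspose_fromRows_eq_fromCols_conjTranspose, Matrix.fromCols_mul_fromRows,
    add_comm]
  simpa using norm_one_add_conjTranspose_mul_self_le Z

/-- The Riccati residual factors as `[-X, I] B [I; X]`, whose outer factors have norm at most `√(1 +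
‖X‖²)`. Estimating the four terms separately would add a linear term in `‖X‖`. -/
theorem norm_fromBlocks_riccati_le :
    ‖B₂₁ + B₂₂ * X - X * B₁₁ - X * B₁₂ * X‖
      ≤ ‖Matrix.fromBlocks B₁₁ B₁₂ B₂₁ B₂₂‖ * (1 + ‖X‖ ^ 2) := by
  have h : B₂₁ + B₂₂ * X - X * B₁₁ - X * B₁₂ * X
      = (leftBasis (-Xᴴ))ᴴ * Matrix.fromBlocks B₁₁ B₁₂ B₂₁ B₂₂ * rightBasis X := by
    rw [conjTranspose_leftBasis_neg, Matrix.mul_assoc (Matrix.fromCols _ _), rightBasis,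
      Matrix.fromBlocks_mul_fromRows, Matrix.fromCols_mul_fromRows]
    simp only [Matrix.mul_one, Matrix.neg_mul, Matrix.mul_add, Matrix.one_mul, Matrix.mul_assoc]
    abel
  have hl := norm_leftBasis_le (-Xᴴ)
  rw [norm_neg, Matrix.l2_opNorm_conjTranspose] at hl
  rw [h]
  calc _ ≤ ‖(leftBasis (-Xᴴ))ᴴ‖ * ‖Matrix.fromBlocks B₁₁ B₁₂ B₂₁ B₂₂‖ * ‖rightBasis X‖ :=
        (Matrix.l2_opNorm_mul _ _).trans (by gcongr; exact Matrix.l2_opNorm_mul _ _)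
    _ ≤ √(1 + ‖X‖ ^ 2) * ‖Matrix.fromBlocks B₁₁ B₁₂ B₂₁ B₂₂‖ * √(1 + ‖X‖ ^ 2) := by
        rw [Matrix.l2_opNorm_conjTranspose]
        gcongr
        exact norm_rightBasis_le X
    _ = ‖Matrix.fromBlocks B₁₁ B₁₂ B₂₁ B₂₂‖ * (√(1 + ‖X‖ ^ 2)) ^ 2 := by ring
    _ = _ := by rw [Real.sq_sqrt (by positivity)]

end Riccati

/-! ### Solving the Riccati equation -/

/-- The Sylvester operator `X ↦ A X - X B`. -/
def sylvester {p q : Type*} [Fintype p] [Fintype q] (A : Matrix p p ℂ) (B : Matrix q q ℂ) :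
    Matrix p q ℂ →ₗ[ℂ] Matrix p q ℂ where
  toFun X := A * X - X * B
  map_add' X Y := by rw [Matrix.mul_add, Matrix.add_mul]; abel
  map_smul' c X := by simp [smul_sub]

theorem sep_mul_norm_le {p q : Type*} [Fintype p] [DecidableEq p] [Fintype q] [DecidableEq q]
    (A : Matrix p p ℂ) (B : Matrix q q ℂ) (X : Matrix p q ℂ) :
    sep A B * ‖X‖ ≤ ‖sylvester A B X‖ := by
  rcases eq_or_ne X 0 with rfl | hX
  · simp
  have hX' : 0 < ‖X‖ := norm_pos_iff.2 hX
  have h : sep A B ≤ ‖sylvester A B ((‖X‖ : ℂ)⁻¹ • X)‖ :=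
    csInf_le ⟨0, by rintro _ ⟨Y, -, rfl⟩; exact norm_nonneg _⟩
      ⟨_, by simp [norm_smul, hX'.ne'], rfl⟩
  rw [map_smul, norm_smul, norm_inv, Complex.norm_real, norm_norm, inv_mul_eq_div] at h
  exact (le_div_iff₀ hX').1 h

/-- Over an empty index type the only matrix is zero, so the infimum is over the empty set, where
`sInf` is `0`. This recovers `m, k ≥ 1` from the positivity of `sep`. -/
theorem nonempty_of_sep_pos {p q : Type*} [Fintype p] [DecidableEq p] [Fintype q] [DecidableEq q]
    {A : Matrix p p ℂ} {B : Matrix q q ℂ} (h : 0 < sep A B) : Nonempty p ∧ Nonempty q := by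
  by_contra hc
  have hs : Subsingleton (Matrix p q ℂ) := by
    rw [not_and_or, not_nonempty_iff, not_nonempty_iff] at hc
    rcases hc with hc | hc <;> exact ⟨fun X Y => by ext i j; exact hc.elim ‹_›⟩
  have he : {r : ℝ | ∃ X : Matrix p q ℂ, ‖X‖ = 1 ∧ r = ‖A * X - X * B‖} = ∅ := by
    ext r
    simp only [Set.mem_ofPred_eq, Set.mem_empty_iff_false, iff_false]
    rintro ⟨X, hX, -⟩
    rw [Subsingleton.elim X 0, norm_zero] at hX
    exact zero_ne_one hX
  rw [sep, he, Real.sInf_empty] at h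
  exact h.false

theorem contDiff_sub_mul_mul {p q : Type*} [Fintype p] [DecidableEq p] [Fintype q] [DecidableEq q]
    (C : Matrix p q ℂ) (L : Matrix p q ℂ →ₗ[ℂ] Matrix p q ℂ) (B : Matrix q p ℂ) :
    ContDiff ℂ 1 fun X : Matrix p q ℂ => X * B * X - C - L X := by
  have h : IsBoundedBilinearMap ℂ fun P : Matrix p q ℂ × Matrix p q ℂ => P.1 * B * P.2 :=
    { add_left := fun X Y Z => by simp [Matrix.add_mul]
      smul_left := fun c X Y => by simp
      add_right := fun X Y Z => by simp [Matrix.mul_add]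
      smul_right := fun c X Y => by simp
      bound := ⟨‖B‖ + 1, by positivity, fun X Y => by
        calc ‖X * B * Y‖ ≤ ‖X‖ * ‖B‖ * ‖Y‖ :=
              (Matrix.l2_opNorm_mul _ _).trans (by gcongr; exact Matrix.l2_opNorm_mul _ _)
          _ ≤ ‖X‖ * (‖B‖ + 1) * ‖Y‖ := by gcongr; linarith
          _ = _ := by ring⟩ }
  exact ((h.contDiff.comp (contDiff_id.prodMk contDiff_id)).sub contDiff_const).sub
    (LinearMap.toContinuousLinearMap L).contDiff

/-- A linear bijection bounded below, perturbed by a quadratic map, has exactly one zero in a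
suitable ball. -/
theorem existsUnique_riccati {p q : Type*} [Fintype p] [DecidableEq p] [Fintype q] [DecidableEq q]
    (T L : Matrix p q ℂ →ₗ[ℂ] Matrix p q ℂ) (C : Matrix p q ℂ) (B : Matrix q p ℂ)
    {s ε γ ρ : ℝ} (hs : 0 < s) (hε : 0 ≤ ε) (hγ : 0 ≤ γ) (hρ : 0 < ρ)
    (hT : ∀ X, s * ‖X‖ ≤ ‖T X‖)
    (hQ : ∀ X, ‖X * B * X - C - L X‖ ≤ ε + γ * ‖X‖ ^ 2) (hερ : ε + γ * ρ ^ 2 < s * ρ) :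
    ∃! X, ‖X‖ ≤ ρ ∧ T X = X * B * X - C - L X := by
  have hinj : Function.Injective T := by
    refine (injective_iff_map_eq_zero T).2 fun X hX => ?_
    have := hT X
    rw [hX, norm_zero] at this
    exact norm_le_zero_iff.1 (nonpos_of_mul_nonpos_right this hs)
  let e := LinearEquiv.ofInjectiveEndo T hinj
  have he : ∀ X, e X = T X := fun X => rfl
  have key := existsUnique_fixedPoint_of_mapsTo_closedBall (ρ := ρ)
    -- The image lies within radius `(ε + γρ²) / s < ρ`; the midpoint with `ρ` is still below `ρ`
    -- and is positive even when `ε = γ = 0`.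
    (η := ((ε + γ * ρ ^ 2) / s + ρ) / 2)
    (φ := fun X => e.symm (X * B * X - C - L X))
    ((LinearMap.toContinuousLinearMap e.symm.toLinearMap).contDiff.comp
      (contDiff_sub_mul_mul C L B))
    (by positivity) (by have := (div_lt_iff₀' hs).2 hερ; linarith) (fun X hX => by
      have h1 := hT (e.symm (X * B * X - C - L X))
      rw [← he, e.apply_symm_apply] at h1
      have h2 : ‖e.symm (X * B * X - C - L X)‖ ≤ (ε + γ * ρ ^ 2) / s :=
        (le_div_iff₀' hs).2 (h1.trans ((hQ X).trans (by gcongr)))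
      have := (div_lt_iff₀' hs).2 hερ
      linarith)
  refine (existsUnique_congr fun X => and_congr_right fun _ => ?_).1 key
  rw [LinearEquiv.symm_apply_eq, eq_comm, he]

/-- `ρ = s / (2γ)` is the vertex of `γρ² - sρ + ε`, whose value there is negative exactly because
`4εγ < s²`. The ball also contains the radius `2ε / s` needed for uniqueness. If `γ = 0`, then `ε =
0` and any radius works. -/
theorem exists_radius {s ε γ : ℝ} (hs : 0 < s) (hε : 0 ≤ ε) (hεγ : ε ≤ γ)
    (h : 4 * ε * γ < s ^ 2) :
    ∃ ρ, 0 < ρ ∧ 2 * ε / s ≤ ρ ∧ 2 * γ * ρ ≤ s ∧ ε + γ * ρ ^ 2 < s * ρ := by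
  rcases (hε.trans hεγ).eq_or_lt with h0 | h0
  · obtain rfl : ε = 0 := le_antisymm (h0 ▸ hεγ) hε
    exact ⟨1, one_pos, by simp, by simpa [← h0] using hs.le, by simpa [← h0] using hs⟩
  · refine ⟨s / (2 * γ), by positivity, ?_, by field_simp; rfl, ?_⟩
    · rw [div_le_div_iff₀ hs (by positivity)]
      nlinarith
    · have h1 : s * (s / (2 * γ)) - γ * (s / (2 * γ)) ^ 2 = s ^ 2 / (4 * γ) := by
        field_simp; ring
      have h2 : ε < s ^ 2 / (4 * γ) := (lt_div_iff₀ (by positivity)).2 (by linarith)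
      linarith

/-- The quadratic inequality excludes values strictly between the roots, and `2γx ≤ s` puts `x` left
of the vertex, hence below the smaller root, written here in rationalised form so that `γ = 0` is
allowed. -/
theorem le_smaller_root {s ε γ x : ℝ} (hs : 0 < s) (hx0 : 0 ≤ x)
    (hx : 2 * γ * x ≤ s) (hq : s * x ≤ ε + γ * x ^ 2) (hγ : 0 ≤ γ) :
    x ≤ 2 * ε / (s + √(s ^ 2 - 4 * γ * ε)) := by
  have h1 : √(s ^ 2 - 4 * γ * ε) ≤ s - 2 * γ * x :=
    Real.sqrt_le_iff.2 ⟨by linarith, by nlinarith⟩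
  rw [le_div_iff₀ (by positivity)]
  nlinarith

/-! ### Canonical angles of graph subspaces -/

theorem norm_toEuclideanLin_le {q p : Type*} [Fintype q] [Fintype p] [DecidableEq p]
    (Z : Matrix q p ℂ) (v : EuclideanSpace ℂ p) :
    ‖Matrix.toEuclideanLin Z v‖ ≤ ‖Z‖ * ‖v‖ :=
  (LinearMap.toContinuousLinearMap (Matrix.toEuclideanLin Z)).le_opNorm v

theorem inner_toEuclideanLin_toEuclideanLin {n p q : Type*} [Fintype n] [Fintype p]
    [DecidableEq p] [Fintype q] [DecidableEq q] (X : Matrix n p ℂ) (Y : Matrix n q ℂ)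
    (v : EuclideanSpace ℂ p) (w : EuclideanSpace ℂ q) :
    inner ℂ (Matrix.toEuclideanLin X v) (Matrix.toEuclideanLin Y w)
      = inner ℂ (Matrix.toEuclideanLin (Yᴴ * X) v) w := by
  classical
  rw [← LinearMap.adjoint_inner_left, ← Matrix.toEuclideanLin_conjTranspose_eq_adjoint]
  congr 1
  ext i
  simp [Matrix.toLpLin_apply, Matrix.mulVec_mulVec]

/-- The spectral norm is attained at a unit right singular vector. -/
theorem exists_norm_eq_one_conjTranspose_mul_self {q p : Type*} [Fintype q] [DecidableEq q]
    [Fintype p] [DecidableEq p] [Nonempty p] (Z : Matrix q p ℂ) :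
    ∃ v : EuclideanSpace ℂ p, ‖v‖ = 1 ∧
      Matrix.toEuclideanLin (Zᴴ * Z) v = ((‖Z‖ ^ 2 : ℝ) : ℂ) • v := by
  let T := LinearMap.toContinuousLinearMap (Matrix.toEuclideanLin Z)
  have hne : (Metric.sphere (0 : EuclideanSpace ℂ p) 1).Nonempty :=
    NormedSpace.sphere_nonempty.2 zero_le_one
  obtain ⟨v, hv, hmax⟩ := (isCompact_sphere (0 : EuclideanSpace ℂ p) 1).exists_isMaxOn hne
    T.continuous.norm.continuousOn
  have hv1 : ‖v‖ = 1 := by simpa using hv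
  have hZ : ‖T‖ = ‖T v‖ := by
    refine le_antisymm (T.opNorm_le_of_unit_norm (norm_nonneg _) fun x hx => ?_) ?_
    · exact hmax (show x ∈ Metric.sphere 0 1 by simpa using hx)
    · simpa [hv1] using T.le_opNorm v
  have hZ' : ‖Z‖ = ‖Matrix.toEuclideanLin Z v‖ := hZ
  refine ⟨v, hv1, ?_⟩
  set w := Matrix.toEuclideanLin (Zᴴ * Z) v with hw
  have hin : inner ℂ w v = ((‖Z‖ ^ 2 : ℝ) : ℂ) := by
    rw [hw, ← inner_toEuclideanLin_toEuclideanLin, inner_self_eq_norm_sq_to_K, ← hZ']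
    simp
  have hle : ‖w‖ ≤ ‖Z‖ ^ 2 := by
    have := norm_toEuclideanLin_le (Zᴴ * Z) v
    rwa [Matrix.l2_opNorm_conjTranspose_mul_self, hv1, mul_one, ← sq] at this
  -- Equality case of Cauchy–Schwarz: with `μ = ‖Z‖²`, `⟨w, v⟩ = μ` and `‖w‖ ≤ μ`, the square
  -- expands to `‖w‖² - 2μ² + μ² ≤ 0`.
  have h0 : ‖w - ((‖Z‖ ^ 2 : ℝ) : ℂ) • v‖ ^ 2 ≤ 0 := by
    rw [@norm_sub_sq ℂ, inner_smul_right, hin, norm_smul, hv1, Complex.norm_real,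
      Real.norm_of_nonneg (by positivity), ← Complex.ofReal_mul]
    simp only [RCLike.re_to_complex, Complex.ofReal_re]
    nlinarith [norm_nonneg w]
  exact sub_eq_zero.1 (norm_eq_zero.1 (pow_eq_zero_iff two_ne_zero |>.1
    (le_antisymm h0 (by positivity))))

/-- The largest canonical angle between the span of `U` and the graph of `Z` over it. -/
theorem thetaMax_colSpan_add_mul {n p q : Type*} [Fintype n] [Fintype p] [DecidableEq p]
    [Nonempty p] [Fintype q] [DecidableEq q] {U : Matrix n p ℂ} {V : Matrix n q ℂ}
    (hU : Uᴴ * U = 1) (hV : Vᴴ * V = 1) (hUV : Uᴴ * V = 0) (Z : Matrix q p ℂ) :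
    thetaMax (colSpan U) (colSpan (U + V * Z)) = Real.arctan ‖Z‖ := by
  classical
  set W := U + V * Z with hW
  have hUW : Uᴴ * W = 1 := by
    rw [hW, Matrix.mul_add, hU, ← Matrix.mul_assoc, hUV, Matrix.zero_mul, add_zero]
  have hWU : Wᴴ * U = 1 := by simpa using congrArg Matrix.conjTranspose hUW
  have hWW : Wᴴ * W = 1 + Zᴴ * Z := by
    conv_lhs => rw [hW, Matrix.mul_add, hWU, Matrix.conjTranspose_add, Matrix.conjTranspose_mul,
      Matrix.add_mul, ← Matrix.mul_assoc, hUV, Matrix.zero_mul, zero_add, Matrix.mul_assoc,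
      ← Matrix.mul_assoc Vᴴ, hV, Matrix.one_mul]
  clear_value W
  have hpos : 0 < 1 + ‖Z‖ ^ 2 := by positivity
  have hnormW : ∀ v, ‖Matrix.toEuclideanLin W v‖ ^ 2
      = ‖v‖ ^ 2 + ‖Matrix.toEuclideanLin Z v‖ ^ 2 := by
    intro v
    have h := inner_toEuclideanLin_toEuclideanLin W W v v
    rw [hWW, map_add, LinearMap.add_apply, inner_add_left,
      ← inner_toEuclideanLin_toEuclideanLin Z Z] at h
    simp only [Matrix.toLpLin_one, LinearMap.id_apply, inner_self_eq_norm_sq_to_K] at h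
    exact_mod_cast h
  -- The cosine is the least length of a projected unit vector; `1 / √(1 + ‖Z‖²)` is the cosine of
  -- `arctan ‖Z‖`.
  have hcos : IsLeast {r : ℝ | ∃ u ∈ colSpan U, ‖u‖ = 1 ∧ r = ‖(colSpan W).starProjection u‖}
      (√(1 + ‖Z‖ ^ 2))⁻¹ := by
    constructor
    · obtain ⟨v, hv, hZv⟩ := exists_norm_eq_one_conjTranspose_mul_self Z
      have hWv : ‖Matrix.toEuclideanLin W v‖ = √(1 + ‖Z‖ ^ 2) := by
        have h := inner_toEuclideanLin_toEuclideanLin W W v v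
        rw [hWW, map_add, LinearMap.add_apply, hZv, inner_add_left, inner_smul_left] at h
        simp only [Matrix.toLpLin_one, LinearMap.id_apply, inner_self_eq_norm_sq_to_K, hv] at h
        rw [Complex.conj_ofReal] at h
        rw [eq_comm, Real.sqrt_eq_iff_mul_self_eq (by positivity) (norm_nonneg _), ← sq]
        have h' : ((‖Matrix.toEuclideanLin W v‖ ^ 2 : ℝ) : ℂ) = ((1 + ‖Z‖ ^ 2 : ℝ) : ℂ) := by
          push_cast
          simpa using h
        exact_mod_cast h'.symm
      refine ⟨Matrix.toEuclideanLin U v, ⟨v, rfl⟩,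
        by rw [norm_toEuclideanLin_of_isometry hU, hv], ?_⟩
      -- For a top right singular vector `v`, `WᴴW v = (1 + ‖Z‖²) v`, while `WᴴU = 1`; so the
      -- residual is orthogonal to the columns of `W`.
      have hP : (colSpan W).starProjection (Matrix.toEuclideanLin U v)
          = (((1 + ‖Z‖ ^ 2 : ℝ) : ℂ)⁻¹) • Matrix.toEuclideanLin W v := by
        refine Submodule.eq_starProjection_of_mem_of_inner_eq_zero (K := colSpan W)
          (Submodule.smul_mem _ _ ⟨v, rfl⟩) ?_
        rintro _ ⟨w, rfl⟩
        rw [inner_sub_left, inner_smul_left, inner_toEuclideanLin_toEuclideanLin,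
          inner_toEuclideanLin_toEuclideanLin, hWU, hWW, map_add, LinearMap.add_apply, hZv,
          inner_add_left, inner_smul_left, ← Complex.ofReal_inv, Complex.conj_ofReal,
          Complex.conj_ofReal]
        simp only [Matrix.toLpLin_one, LinearMap.id_apply]
        have : ((1 + ‖Z‖ ^ 2 : ℝ) : ℂ) ≠ 0 := by exact_mod_cast hpos.ne'
        push_cast at this ⊢
        field_simp
        ring
      rw [hP, norm_smul, hWv, norm_inv, Complex.norm_real, Real.norm_of_nonneg hpos.le]
      have h2 := Real.mul_self_sqrt hpos.le
      have h3 := (Real.sqrt_pos.2 hpos).ne'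
      nth_rewrite 2 [← h2]
      field_simp
    · rintro _ ⟨_, ⟨v, rfl⟩, hv, rfl⟩
      rw [norm_toEuclideanLin_of_isometry hU] at hv
      set P := (colSpan W).starProjection (Matrix.toEuclideanLin U v) with hP
      -- Testing the projection against `W v` gives `1`, so Cauchy–Schwarz yields `‖P‖ ≥ 1 / ‖W v‖`.
      have h1 : inner ℂ P (Matrix.toEuclideanLin W v) = 1 := by
        rw [hP, Submodule.inner_starProjection_left_eq_right,
          Submodule.starProjection_eq_self_iff.2 (show _ ∈ colSpan W from ⟨v, rfl⟩), inner_toEuclideanLin_toEuclideanLin, hWU]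
        simp [hv]
      have h2 : ‖Matrix.toEuclideanLin W v‖ ≤ √(1 + ‖Z‖ ^ 2) := by
        refine Real.le_sqrt_of_sq_le ?_
        have := norm_toEuclideanLin_le Z v
        rw [hv, mul_one] at this
        rw [hnormW, hv]
        nlinarith [norm_nonneg (Matrix.toEuclideanLin Z v)]
      have h3 := norm_inner_le_norm (𝕜 := ℂ) P (Matrix.toEuclideanLin W v)
      rw [h1, norm_one] at h3
      rw [inv_le_iff_one_le_mul₀ (Real.sqrt_pos.2 hpos)]
      exact h3.trans (by gcongr)
  have h1 := isLeast_sigmaMin_isometry hU (isometryOf_isometry (colSpan W))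
  have h2 := thetaMax_eq hU (isometryOf_isometry (colSpan W))
  rw [colSpan_isometryOf] at h1 h2
  rw [h2, h1.unique hcos, Real.arctan_eq_arccos (norm_nonneg _)]

theorem thetaMax_rightBasis {m k : ℕ} [Nonempty (Fin m)] (X : Matrix (Fin k) (Fin m) ℂ) :
    thetaMax (colSpan (rightBasis (0 : Matrix (Fin k) (Fin m) ℂ))) (colSpan (rightBasis X))
      = Real.arctan ‖X‖ := by
  have h := thetaMax_colSpan_add_mul (U := rightBasis (0 : Matrix (Fin k) (Fin m) ℂ))
    (V := leftBasis 0)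
    (by simp [rightBasis, Matrix.conjTranspose_fromRows_eq_fromCols_conjTranspose,
      Matrix.fromCols_mul_fromRows])
    (by simp [leftBasis, Matrix.conjTranspose_fromRows_eq_fromCols_conjTranspose,
      Matrix.fromCols_mul_fromRows])
    (by simp [leftBasis, rightBasis, Matrix.conjTranspose_fromRows_eq_fromCols_conjTranspose,
      Matrix.fromCols_mul_fromRows]) X
  have hX : rightBasis (0 : Matrix (Fin k) (Fin m) ℂ)
      + leftBasis (0 : Matrix (Fin m) (Fin k) ℂ) * X = rightBasis X := by
    rw [leftBasis, Matrix.fromRows_mul]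
    ext (i | i) j <;> simp [rightBasis]
  rwa [hX] at h

theorem thetaMax_leftBasis {m k : ℕ} [Nonempty (Fin k)] (Z : Matrix (Fin m) (Fin k) ℂ) :
    thetaMax (colSpan (leftBasis (0 : Matrix (Fin m) (Fin k) ℂ))) (colSpan (leftBasis Z))
      = Real.arctan ‖Z‖ := by
  have h := thetaMax_colSpan_add_mul (U := leftBasis (0 : Matrix (Fin m) (Fin k) ℂ))
    (V := rightBasis 0)
    (by simp [leftBasis, Matrix.conjTranspose_fromRows_eq_fromCols_conjTranspose,
      Matrix.fromCols_mul_fromRows])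
    (by simp [rightBasis, Matrix.conjTranspose_fromRows_eq_fromCols_conjTranspose,
      Matrix.fromCols_mul_fromRows])
    (by simp [leftBasis, rightBasis, Matrix.conjTranspose_fromRows_eq_fromCols_conjTranspose,
      Matrix.fromCols_mul_fromRows]) Z
  have hZ : leftBasis (0 : Matrix (Fin m) (Fin k) ℂ)
      + rightBasis (0 : Matrix (Fin k) (Fin m) ℂ) * Z = leftBasis Z := by
    rw [rightBasis, Matrix.fromRows_mul]
    ext (i | i) j <;> simp [leftBasis]
  rwa [hZ] at h

/-! ### The perturbation theorem -/

theorem mainTheorem2 {m k : ℕ}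
    (A₁₁ E₁₁ : Matrix (Fin m) (Fin m) ℂ) (A₁₂ E₁₂ : Matrix (Fin m) (Fin k) ℂ)
    (E₂₁ : Matrix (Fin k) (Fin m) ℂ) (A₂₂ E₂₂ : Matrix (Fin k) (Fin k) ℂ)
    (A E : Matrix (Fin m ⊕ Fin k) (Fin m ⊕ Fin k) ℂ)
    (hA : A = Matrix.fromBlocks A₁₁ A₁₂ 0 A₂₂)
    (hE : E = Matrix.fromBlocks E₁₁ E₁₂ E₂₁ E₂₂)
    (s : ℝ) (hs : s = sep A₂₂ A₁₁) (hs_pos : 0 < s)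
    (hsmall : 4 * ‖E‖ * (‖E‖ + ‖A₁₂‖) < s ^ 2) :
    ∃ X : Matrix (Fin k) (Fin m) ℂ,
      -- right and left invariant pairs
      IsRightInvariantPair (A + E) (rightBasis X)
        (A₁₁ + E₁₁ + (A₁₂ + E₁₂) * X) ∧
      IsLeftInvariantPair (A + E) (leftBasis (-Xᴴ))
        (A₂₂ + E₂₂ - X * (A₁₂ + E₁₂)) ∧
      -- uniqueness of `X` among the matrices of norm at most `2‖E‖/s`
      (∀ X' : Matrix (Fin k) (Fin m) ℂ,
        IsRightInvariantPair (A + E) (rightBasis X')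
          (A₁₁ + E₁₁ + (A₁₂ + E₁₂) * X') →
        IsLeftInvariantPair (A + E) (leftBasis (-X'ᴴ))
          (A₂₂ + E₂₂ - X' * (A₁₂ + E₁₂)) →
        ‖X'‖ ≤ 2 * ‖E‖ / s → X' = X) ∧
      -- the subspaces are invariant
      IsInvariantSubspace A (colSpan (rightBasis (0 : Matrix (Fin k) (Fin m) ℂ))) ∧
      IsInvariantSubspace (A + E) (colSpan (rightBasis X)) ∧
      IsInvariantSubspace Aᴴ (colSpan (leftBasis (0 : Matrix (Fin m) (Fin k) ℂ))) ∧
      IsInvariantSubspace (A + E)ᴴ (colSpan (leftBasis (-Xᴴ))) ∧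
      -- both largest canonical angles are acute, with tangent `‖X‖`
      thetaMax (colSpan (rightBasis 0)) (colSpan (rightBasis X)) < Real.pi / 2 ∧
      thetaMax (colSpan (leftBasis 0)) (colSpan (leftBasis (-Xᴴ))) < Real.pi / 2 ∧
      Real.tan (thetaMax (colSpan (rightBasis 0)) (colSpan (rightBasis X))) = ‖X‖ ∧
      Real.tan (thetaMax (colSpan (leftBasis 0)) (colSpan (leftBasis (-Xᴴ)))) = ‖X‖ ∧
      -- the bounds
      ‖X‖ ≤ 2 * ‖E‖ / (s + √(s ^ 2 - 4 * (‖A₁₂‖ + ‖E‖) * ‖E‖)) ∧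
      2 * ‖E‖ / (s + √(s ^ 2 - 4 * (‖A₁₂‖ + ‖E‖) * ‖E‖)) ≤ 2 * ‖E‖ / s := by
  obtain ⟨hk, hm⟩ := nonempty_of_sep_pos (hs ▸ hs_pos)
  have hT : ∀ X, s * ‖X‖ ≤ ‖sylvester A₂₂ A₁₁ X‖ := fun X => hs ▸ sep_mul_norm_le A₂₂ A₁₁ X
  have hAE : A + E = Matrix.fromBlocks (A₁₁ + E₁₁) (A₁₂ + E₁₂) E₂₁ (A₂₂ + E₂₂) := by
    rw [hA, hE, Matrix.fromBlocks_add, zero_add]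
  have hγ : 0 ≤ ‖A₁₂‖ + ‖E‖ := by positivity
  have hsmall' : 4 * ‖E‖ * (‖A₁₂‖ + ‖E‖) < s ^ 2 := by rwa [add_comm ‖A₁₂‖]
  obtain ⟨ρ, hρ0, hρ1, hρ2, hρ3⟩ := exists_radius hs_pos (norm_nonneg E)
    (le_add_of_nonneg_left (norm_nonneg A₁₂)) hsmall'
  have hQ : ∀ X : Matrix (Fin k) (Fin m) ℂ,
      ‖X * (A₁₂ + E₁₂) * X - E₂₁ - sylvester E₂₂ E₁₁ X‖
        ≤ ‖E‖ + (‖A₁₂‖ + ‖E‖) * ‖X‖ ^ 2 := by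
    intro X
    have h1 := norm_fromBlocks_riccati_le E₁₁ E₁₂ E₂₁ E₂₂ X
    rw [← hE] at h1
    have h2 : ‖X * A₁₂ * X‖ ≤ ‖X‖ * ‖A₁₂‖ * ‖X‖ :=
      (Matrix.l2_opNorm_mul _ _).trans (by gcongr; exact Matrix.l2_opNorm_mul _ _)
    -- All `E` terms are grouped to form the residual of `E`, bounded by `‖E‖ (1 + ‖X‖²)`; only `X
    -- A₁₂ X` is left over.
    have h3 : X * (A₁₂ + E₁₂) * X - E₂₁ - sylvester E₂₂ E₁₁ X
        = X * A₁₂ * X - (E₂₁ + E₂₂ * X - X * E₁₁ - X * E₁₂ * X) := by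
      simp only [sylvester, LinearMap.coe_mk, AddHom.coe_mk, Matrix.mul_add, Matrix.add_mul]
      abel
    rw [h3]
    refine (norm_sub_le _ _).trans ?_
    linarith [add_le_add h2 h1]
  have hric : ∀ X : Matrix (Fin k) (Fin m) ℂ,
      E₂₁ + (A₂₂ + E₂₂) * X = X * (A₁₁ + E₁₁) + X * (A₁₂ + E₁₂) * X ↔
        sylvester A₂₂ A₁₁ X = X * (A₁₂ + E₁₂) * X - E₂₁ - sylvester E₂₂ E₁₁ X := by
    intro X
    rw [← sub_eq_zero, ← sub_eq_zero (a := sylvester A₂₂ A₁₁ X)]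
    refine Eq.congr ?_ rfl
    simp only [sylvester, LinearMap.coe_mk, AddHom.coe_mk, Matrix.mul_add, Matrix.add_mul]
    abel
  obtain ⟨X, ⟨hXρ, hX⟩, huniq⟩ := existsUnique_riccati (sylvester A₂₂ A₁₁) (sylvester E₂₂ E₁₁)
    E₂₁ (A₁₂ + E₁₂) hs_pos (norm_nonneg E) hγ hρ0 hT hQ hρ3
  have hright : (A + E) * rightBasis X = rightBasis X * (A₁₁ + E₁₁ + (A₁₂ + E₁₂) * X) := by
    rw [hAE, fromBlocks_mul_rightBasis_iff, hric, hX]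
  have hleft : (leftBasis (-Xᴴ))ᴴ * (A + E)
      = (A₂₂ + E₂₂ - X * (A₁₂ + E₁₂)) * (leftBasis (-Xᴴ))ᴴ := by
    rw [hAE, leftBasis_mul_fromBlocks_iff, hric, hX]
  have hθ₁ := thetaMax_rightBasis X
  have hθ₂ := thetaMax_leftBasis (-Xᴴ)
  rw [norm_neg, Matrix.l2_opNorm_conjTranspose] at hθ₂
  refine ⟨X, ⟨rank_rightBasis X, hright⟩, ⟨rank_leftBasis _, hleft⟩, ?_, ?_,
    isInvariantSubspace_colSpan hright, ?_, ?_, ?_, ?_, ?_, ?_, ?_, ?_⟩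
  · rintro X' ⟨-, hX'⟩ - hn
    rw [hAE, fromBlocks_mul_rightBasis_iff, hric] at hX'
    -- Uniqueness holds in the larger ball of radius `ρ ≥ 2‖E‖ / s`.
    exact huniq X' ⟨hn.trans hρ1, hX'⟩
  · refine isInvariantSubspace_colSpan (M := A₁₁ + A₁₂ * (0 : Matrix (Fin k) (Fin m) ℂ)) ?_
    rw [hA, fromBlocks_mul_rightBasis_iff]
    simp
  · refine isInvariantSubspace_colSpan (M := A₂₂ᴴ) ?_
    rw [hA, Matrix.fromBlocks_conjTranspose, leftBasis, Matrix.fromBlocks_mul_fromRows,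
      Matrix.fromRows_mul]
    simp
  · refine isInvariantSubspace_colSpan (M := (A₂₂ + E₂₂ - X * (A₁₂ + E₁₂))ᴴ) ?_
    simpa only [Matrix.conjTranspose_mul, Matrix.conjTranspose_conjTranspose] using
      congrArg Matrix.conjTranspose hleft
  · rw [hθ₁]
    exact Real.arctan_lt_pi_div_two _
  · rw [hθ₂]
    exact Real.arctan_lt_pi_div_two _
  · rw [hθ₁, Real.tan_arctan]
  · rw [hθ₂, Real.tan_arctan]
  -- The radius was chosen with `2γρ ≤ s`, so `‖X‖ ≤ ρ` selects the smaller root.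
  · refine le_smaller_root hs_pos (norm_nonneg X) ?_ ((hT X).trans (hX ▸ hQ X)) hγ
    exact (mul_le_mul_of_nonneg_left hXρ (by positivity)).trans hρ2
  · gcongr
    exact le_add_of_nonneg_right (Real.sqrt_nonneg _)
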